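/- Let $n\in\mathbb N$, $0<\beta\le n$ and $0\le\alpha<\beta$. For $E\subseteq\mathbb R^n$ let $$\mathcal H^\beta_\infty(E)=\inf\Big\{\sum_{i=1}^\infty \omega_\beta r_i^\beta : E\subset\bigcup_{i=1}^\infty B(x_i,r_i)\Big\},\qquad \omega_\beta=\frac{\pi^{\beta/2}}{\Gamma(\beta/2+1)},$$ be the Hausdorff content, and for $f\ge 0$ and $\Omega\subseteq\mathbb R^n$ let $\int_\Omega f\,d\mathcal H^\beta_\infty=\int_0^\infty \mathcal H^\beta_\infty(\{x\in\Omega: f(x)>t\})\,dt$ be the Choquet integral. Let $B:[0,\infty)\to[0,\infty)$ be a Young function, i.e. continuous, convex and strictly increasing with $B(0)=0$ and $\lim_{t\to\infty}B(t)=\infty$. Assume that $t\mapsto B(t)/t^{\beta/\alpha}$ is decreasing (in the wide sense) on $(0,\infty)$; for $\alpha=0$ this condition is void. For a cube $Q$ with sides parallel to the axes and side length $\ell(Q)$ put $$\|f\|_{B,Q,\mathcal H^\beta_\infty}=\inf\Big\{\lambda>0:\frac1{\ell(Q)^\beta}\int_Q B\Big(\frac{|f|}{\lambda}\Big)\,d\mathcal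 H^\beta_\infty\le 1\Big\},\qquad \mathcal M_{\alpha,B,\mathcal H^\beta_\infty}f(x)=\sup_{Q\ni x}\ell(Q)^\alpha\|f\|_{B,Q,\mathcal H^\beta_\infty},$$ and let $L^B(\mathbb R^n,\mathcal H^\beta_\infty)$ be the set of all $f:\mathbb R^n\to\mathbb R$ such that $\int_{\mathbb R^n}B(|f|/\lambda)\,d\mathcal H^\beta_\infty<\infty$ for some $\lambda>0$. Put $h_B(s)=\sup_{t>0}B(st)/B(t)$ and $$\Phi_1(0)=0,\qquad \Phi_1(s)=\frac{s}{h_B(s^{\alpha/\beta})}\quad(0<s<\infty),\qquad \Phi_1(\infty)=\sup_{0<s<\infty}\Phi_1(s).$$ Then there is a constant $C=C(n,\beta,\alpha,B)>0$ such that for every constant $0\le C_1<\infty$, every function $\Phi:[0,\infty]\to[0,\infty]$ with $\Phi\le C_1\Phi_1$, every non-negative $f\in L^B(\mathbb R^n,\mathcal H^\beta_\infty)$ and every $t>0$, $$\Phi\Big(\mathcal H^\beta_\infty\big(\{x\in\mathbb R^n:\mathcal M_{\alpha,B,\mathcal H^\beta_\infty}f(x)>t\}\big)\Big)\le C\,C_1\int_{\mathbb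 R^n}B\Big(\frac{f(x)}{t}\Big)\,d\mathcal H^\beta_\infty .$$ -/

import Mathlib

open scoped ENNReal NNReal

noncomputable section

namespace CapacitaryOrlicz

/-- The `β`-dimensional Hausdorff content on `ℝⁿ`: the infimum of `∑ ω_β rᵢ ^ β` over all countable
coverings by Euclidean balls, with `ω_β = π ^ (β/2) / Γ(β/2 + 1)`. -/
def hausdorffContent (n : ℕ) (β : ℝ) (A : Set (EuclideanSpace ℝ (Fin n))) : ℝ≥0∞ :=
  ⨅ (x : ℕ → EuclideanSpace ℝ (Fin n)) (r : ℕ → ℝ) (_ : ∀ i, 0 < r i)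
    (_ : A ⊆ ⋃ i, Metric.ball (x i) (r i)),
    ∑' i, ENNReal.ofReal (Real.pi ^ (β / 2) / Real.Gamma (β / 2 + 1) * r i ^ β)

/-- The Choquet integral `∫_Ω f dH = ∫₀^∞ H {x ∈ Ω | f x > t} dt` of a nonnegative function `f`
(no measurability of `f` is needed: the integrand is nonincreasing in `t`). -/
def choquetIntegral {X : Type*} (H : Set X → ℝ≥0∞) (Ω : Set X) (f : X → ℝ) : ℝ≥0∞ :=
  ∫⁻ t in Set.Ioi (0 : ℝ), H {x | x ∈ Ω ∧ t < f x}

/-- Young functions `B : [0,∞) → [0,∞)`: continuous, convex, strictly increasing, `B 0 = 0` and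
`B t → ∞`. Only the values on `[0,∞)` matter. -/
structure IsYoung (B : ℝ → ℝ) : Prop where
  continuousOn : ContinuousOn B (Set.Ici 0)
  convexOn : ConvexOn ℝ (Set.Ici 0) B
  strictMonoOn : StrictMonoOn B (Set.Ici 0)
  map_zero : B 0 = 0
  tendsto_atTop : Filter.Tendsto B Filter.atTop Filter.atTop

/-- The closed cube with sides of length `ℓ` parallel to the axes and lower corner `a`. -/
def cube {n : ℕ} (a : EuclideanSpace ℝ (Fin n)) (ℓ : ℝ) : Set (EuclideanSpace ℝ (Fin n)) :=
  {y | ∀ i, a i ≤ y i ∧ y i ≤ a i + ℓ}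

/-- Membership in the Orlicz space of `ℝⁿ` with respect to the Hausdorff content: `B (|f| / r)`
has a finite Choquet integral for some `r > 0`. -/
def MemOrlicz {n : ℕ} (β : ℝ) (B : ℝ → ℝ) (f : EuclideanSpace ℝ (Fin n) → ℝ) : Prop :=
  ∃ r : ℝ, 0 < r ∧
    choquetIntegral (hausdorffContent n β) Set.univ (fun x => B (|f x| / r)) < ∞

/-- The mean Luxemburg quasinorm of `f` on the cube with corner `a` and side length `ℓ`. The
average `ℓ ^ (-β) * ∫ ≤ 1` is written as `∫ ≤ ℓ ^ β`; the infimum of the empty set is `∞`. -/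
def luxemburg {n : ℕ} (β : ℝ) (B : ℝ → ℝ) (a : EuclideanSpace ℝ (Fin n)) (ℓ : ℝ)
    (f : EuclideanSpace ℝ (Fin n) → ℝ) : ℝ≥0∞ :=
  ⨅ (r : ℝ) (_ : 0 < r)
    (_ : choquetIntegral (hausdorffContent n β) (cube a ℓ) (fun x => B (|f x| / r))
      ≤ ENNReal.ofReal (ℓ ^ β)),
    ENNReal.ofReal r

/-- The fractional Orlicz maximal operator: the supremum of `ℓ(Q) ^ α * ‖f‖_{B,Q}` over all cubes
`Q` containing `x`. -/
def fracOrliczMaximal {n : ℕ} (α β : ℝ) (B : ℝ → ℝ) (f : EuclideanSpace ℝ (Fin n) → ℝ)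
    (x : EuclideanSpace ℝ (Fin n)) : ℝ≥0∞ :=
  ⨆ (a : EuclideanSpace ℝ (Fin n)) (ℓ : ℝ) (_ : 0 < ℓ) (_ : x ∈ cube a ℓ),
    ENNReal.ofReal (ℓ ^ α) * luxemburg β B a ℓ f

/-- `h_B s = sup_{t > 0} B (s t) / B t`, with values in `[0,∞]`. -/
def dilation (B : ℝ → ℝ) (s : ℝ) : ℝ≥0∞ :=
  ⨆ (t : ℝ) (_ : 0 < t), ENNReal.ofReal (B (s * t) / B t)

/-- `Φ₁ 0 = 0` and `Φ₁ s = s / h_B (s ^ (α/β))` for `0 < s < ∞`. As the content of a set may be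
infinite, `Φ₁` is extended to `s = ∞` by the supremum of its finite values. -/
def phiOne (α β : ℝ) (B : ℝ → ℝ) (s : ℝ≥0∞) : ℝ≥0∞ :=
  if s = 0 then 0
  else if s = ∞ then
    ⨆ (u : ℝ) (_ : 0 < u), ENNReal.ofReal u / dilation B (u ^ (α / β))
  else s / dilation B (s.toReal ^ (α / β))

end CapacitaryOrlicz

end

namespace CapacitaryOrlicz

open MeasureTheory Set

/-! ### The Hausdorff content -/

/-! Write g = f/t and I = ∫ B(g). A point where the maximal function exceeds t lies in a cube of
side ℓ with ℓ^β < ∫ B(ℓ^α g) over it. Passing to a dyadic cube P of comparable side costs a constant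
(`exists_dyadic_of_cube`). Since B(ℓ(P)^α g) ≤ h_B(ℓ(P)^α) B(g), such a P satisfies Φ₁(ℓ(P)^β) ≤ κ
∫_P B(g) (`phiOne_weight_le`).

These estimates must be summed, but the content is not additive even on disjoint cubes. Hence one
keeps a subfamily S of the maximal cubes in which the total weight below any dyadic Q is at most
2ℓ(Q)^β. It still controls the content of the superlevel set
(`exists_isPacked_hausdorffContent_le`), and the integrals over its cubes add up to at most a
constant times I (`exists_tsum_hausdorffContent_inter_le`). Monotonicity and countable subadditivity
of Φ₁ then give the estimate. If the cubes P are arbitrarily large, maximal ones may not exist, but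
then already Φ₁(∞) ≤ κ I. -/

theorem ballVolume_pos {β : ℝ} (hβ : 0 < β) :
    0 < Real.pi ^ (β / 2) / Real.Gamma (β / 2 + 1) :=
  div_pos (Real.rpow_pos_of_pos Real.pi_pos _) (Real.Gamma_pos_of_pos (by positivity))

/-- The contribution of a ball of radius `r` to the Hausdorff content. -/
noncomputable def ballCost (β r : ℝ) : ℝ≥0∞ :=
  ENNReal.ofReal (Real.pi ^ (β / 2) / Real.Gamma (β / 2 + 1) * r ^ β)

theorem exists_ballCost_le {β : ℝ} (hβ : 0 < β) {ε : ℝ≥0∞} (hε : ε ≠ 0) :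
    ∃ r, 0 < r ∧ ballCost β r ≤ ε := by
  have hω := ballVolume_pos hβ
  rcases eq_or_ne ε ∞ with rfl | htop
  · exact ⟨1, one_pos, le_top⟩
  have h0 := ENNReal.toReal_pos hε htop
  refine ⟨(ε.toReal / (Real.pi ^ (β / 2) / Real.Gamma (β / 2 + 1))) ^ β⁻¹, by positivity, ?_⟩
  rw [ballCost, Real.rpow_inv_rpow (by positivity) hβ.ne', mul_div_cancel₀ _ hω.ne',
    ENNReal.ofReal_toReal htop]

variable {n : ℕ} {β : ℝ}

/-- Coverings in the definition are indexed by `ℕ` with positive radii. A finite or empty covering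
is padded with balls of total cost below ε. -/
theorem hausdorffContent_le_tsum {ι : Type*} [Countable ι] (hβ : 0 < β)
    {A : Set (EuclideanSpace ℝ (Fin n))} (x : ι → EuclideanSpace ℝ (Fin n)) (r : ι → ℝ)
    (hr : ∀ i, 0 < r i) (hA : A ⊆ ⋃ i, Metric.ball (x i) (r i)) :
    hausdorffContent n β A ≤ ∑' i, ballCost β (r i) := by
  refine ENNReal.le_of_forall_pos_le_add fun ε hε _ => ?_
  obtain ⟨δ, hδ, hsum⟩ := ENNReal.exists_pos_sum_of_countable' (ε := (ε : ℝ≥0∞))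
    (by simpa using hε.ne') ℕ
  choose ρ hρ hρ' using fun j => exists_ballCost_le hβ (hδ j).ne'
  obtain ⟨e⟩ : Nonempty (ℕ ≃ ι ⊕ ℕ) := nonempty_equiv_of_countable
  have hle : hausdorffContent n β A ≤ ∑' k, ballCost β (Sum.elim r ρ (e k)) := by
    refine iInf_le_of_le (fun k => Sum.elim x (fun _ => 0) (e k)) <|
      iInf_le_of_le (fun k => Sum.elim r ρ (e k)) <| iInf_le_of_le ?_ <| iInf_le_of_le ?_ le_rfl
    · intro k
      change 0 < Sum.elim r ρ (e k)
      rcases e k with i | j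
      · exact hr i
      · exact hρ j
    · intro y hy
      obtain ⟨i, hi⟩ := mem_iUnion.1 (hA hy)
      exact mem_iUnion.2 ⟨e.symm (Sum.inl i), by simpa using hi⟩
  refine hle.trans ?_
  rw [e.tsum_eq fun k => ballCost β (Sum.elim r ρ k),
    Summable.tsum_sum ENNReal.summable ENNReal.summable]
  exact add_le_add le_rfl ((ENNReal.tsum_le_tsum hρ').trans hsum.le)

theorem hausdorffContent_mono {A A' : Set (EuclideanSpace ℝ (Fin n))} (h : A ⊆ A') :
    hausdorffContent n β A ≤ hausdorffContent n β A' :=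
  iInf_mono fun _ => iInf_mono fun _ => iInf_mono fun _ => iInf_mono' fun h' => ⟨h.trans h', le_rfl⟩

theorem hausdorffContent_empty (hβ : 0 < β) :
    hausdorffContent n β (∅ : Set (EuclideanSpace ℝ (Fin n))) = 0 := by
  have := hausdorffContent_le_tsum (n := n) (ι := Empty) (A := ∅) hβ (fun _ => 0) (fun _ => 1)
    (fun _ => one_pos) (empty_subset _)
  simpa using this

theorem exists_cover_of_hausdorffContent_lt {A : Set (EuclideanSpace ℝ (Fin n))} {c : ℝ≥0∞}
    (h : hausdorffContent n β A < c) :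
    ∃ (x : ℕ → EuclideanSpace ℝ (Fin n)) (r : ℕ → ℝ), (∀ i, 0 < r i) ∧
      (A ⊆ ⋃ i, Metric.ball (x i) (r i)) ∧ ∑' i, ballCost β (r i) < c := by
  simp only [hausdorffContent, iInf_lt_iff] at h
  obtain ⟨x, r, hr, hA, hc⟩ := h
  exact ⟨x, r, hr, hA, hc⟩

theorem hausdorffContent_le_tsum_of_subset {ι : Type*} [Countable ι] (hβ : 0 < β)
    {A : Set (EuclideanSpace ℝ (Fin n))} (U : ι → Set (EuclideanSpace ℝ (Fin n)))
    (hA : A ⊆ ⋃ i, U i) :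
    hausdorffContent n β A ≤ ∑' i, hausdorffContent n β (U i) := by
  refine ENNReal.le_of_forall_pos_le_add fun ε hε hfin => ?_
  obtain ⟨δ, hδ, hsum⟩ := ENNReal.exists_pos_sum_of_countable' (ε := (ε : ℝ≥0∞))
    (by simpa using hε.ne') ι
  have hlt : ∀ i, hausdorffContent n β (U i) < hausdorffContent n β (U i) + δ i := fun i =>
    ENNReal.lt_add_right (ENNReal.ne_top_of_tsum_ne_top hfin.ne i) (hδ i).ne'
  choose x r hr hU hc using fun i => exists_cover_of_hausdorffContent_lt (hlt i)
  calc hausdorffContent n β A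
      ≤ ∑' p : ι × ℕ, ballCost β (r p.1 p.2) := by
        refine hausdorffContent_le_tsum hβ (fun p : ι × ℕ => x p.1 p.2) _ (fun p => hr _ _) ?_
        intro y hy
        obtain ⟨i, hi⟩ := mem_iUnion.1 (hA hy)
        obtain ⟨j, hj⟩ := mem_iUnion.1 (hU i hi)
        exact mem_iUnion.2 ⟨(i, j), hj⟩
    _ = ∑' i, ∑' j, ballCost β (r i j) :=
        ENNReal.tsum_prod (f := fun i j => ballCost β (r i j))
    _ ≤ ∑' i, (hausdorffContent n β (U i) + δ i) := ENNReal.tsum_le_tsum fun i => (hc i).le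
    _ ≤ ∑' i, hausdorffContent n β (U i) + ε := by
        rw [ENNReal.tsum_add]
        exact add_le_add le_rfl hsum.le

theorem hausdorffContent_le_ballCost (hβ : 0 < β) {A : Set (EuclideanSpace ℝ (Fin n))}
    {x : EuclideanSpace ℝ (Fin n)} {r : ℝ} (hr : 0 < r) (hA : A ⊆ Metric.ball x r) :
    hausdorffContent n β A ≤ ballCost β r := by
  have := hausdorffContent_le_tsum (ι := Unit) hβ (fun _ => x) (fun _ => r) (fun _ => hr)
    (hA.trans (subset_iUnion_of_subset () le_rfl))
  simpa using this

/-! ### The Choquet integral -/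

section Choquet

variable {X : Type*} {H : Set X → ℝ≥0∞}

/-- Monotonicity in the level supplies all the measurability that the integrals below need. -/
theorem antitone_superlevel (hH : Monotone H) (Ω : Set X) (f : X → ℝ) :
    Antitone fun t : ℝ => H {x | x ∈ Ω ∧ t < f x} :=
  fun _ _ hst => hH fun _ hx => ⟨hx.1, hst.trans_lt hx.2⟩

theorem choquetIntegral_mono (hH : Monotone H) {Ω Ω' : Set X} {f g : X → ℝ} (hΩ : Ω ⊆ Ω')
    (hfg : ∀ x ∈ Ω, f x ≤ g x) : choquetIntegral H Ω f ≤ choquetIntegral H Ω' g :=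
  lintegral_mono fun _ => hH fun _ hx => ⟨hΩ hx.1, hx.2.trans_le (hfg _ hx.1)⟩

theorem choquetIntegral_const_mul (hH : Monotone H) (Ω : Set X) (f : X → ℝ) {c : ℝ}
    (hc : 0 < c) :
    choquetIntegral H Ω (fun x => c * f x) = ENNReal.ofReal c * choquetIntegral H Ω f := by
  have hm := (antitone_superlevel hH Ω f).measurable
  have hm' := (antitone_superlevel hH Ω fun x => c * f x).measurable
  simp only [choquetIntegral]
  rw [← lintegral_indicator measurableSet_Ioi, ← lintegral_indicator measurableSet_Ioi]
  -- Substitution t ↦ c t: Lebesgue measure is c times its own image under multiplication by c.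
  conv_lhs => rw [← Real.smul_map_volume_mul_left hc.ne']
  rw [lintegral_smul_measure, lintegral_map (hm'.indicator measurableSet_Ioi) (by fun_prop),
    abs_of_pos hc, smul_eq_mul]
  congr 1
  refine lintegral_congr fun t => ?_
  simp only [indicator, mem_Ioi, mul_pos_iff_of_pos_left hc, mul_lt_mul_iff_right₀ hc]

theorem choquetIntegral_le_tsum {ι : Type*} [Countable ι] (hH : Monotone H)
    (hsub : ∀ (A : Set X) (U : ι → Set X), A ⊆ ⋃ i, U i → H A ≤ ∑' i, H (U i))
    (Ω : Set X) (U : ι → Set X) (hΩ : Ω ⊆ ⋃ i, U i) (f : X → ℝ) :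
    choquetIntegral H Ω f ≤ ∑' i, choquetIntegral H (Ω ∩ U i) f := by
  simp only [choquetIntegral]
  rw [← lintegral_tsum fun i => ((antitone_superlevel hH (Ω ∩ U i) f).measurable).aemeasurable]
  refine lintegral_mono fun t => hsub _ _ fun x hx => ?_
  obtain ⟨i, hi⟩ := mem_iUnion.1 (hΩ hx.1)
  exact mem_iUnion.2 ⟨i, ⟨hx.1, hi⟩, hx.2⟩

theorem tsum_choquetIntegral_le {ι : Type*} [Countable ι] (hH : Monotone H) (U : ι → Set X)
    {K : ℝ≥0} (hK : ∀ A : Set X, ∑' i, H (A ∩ U i) ≤ K * H A) (f : X → ℝ) :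
    ∑' i, choquetIntegral H (U i) f ≤ K * choquetIntegral H univ f := by
  simp only [choquetIntegral]
  rw [← lintegral_tsum fun i => ((antitone_superlevel hH (U i) f).measurable).aemeasurable,
    ← lintegral_const_mul _ (antitone_superlevel hH univ f).measurable]
  refine lintegral_mono fun t => ?_
  refine le_trans (ENNReal.tsum_le_tsum fun i => ?_) (hK {x | x ∈ univ ∧ t < f x})
  exact hH fun x hx => ⟨⟨mem_univ _, hx.2⟩, hx.1⟩

theorem choquetIntegral_empty (h0 : H ∅ = 0) (f : X → ℝ) : choquetIntegral H ∅ f = 0 := by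
  simp [choquetIntegral, h0]

end Choquet

/-! ### Selecting a subfamily with the packing condition -/

section Packing

variable {D : Type*} [Preorder D]

/-- The family `S` satisfies the packing condition with respect to the weight `w`. -/
def IsPacked (w : D → ℝ≥0∞) (S : Set D) : Prop :=
  ∀ Q, ∑' P, (S ∩ Iic Q).indicator w P ≤ 2 * w Q

/-- Packing only concerns finite partial sums, and a finite part of the union of a chain lies in one
member. This is the chain condition for Zorn's lemma. -/
theorem isPacked_sUnion {w : D → ℝ≥0∞} {c : Set (Set D)} (hc : IsChain (· ⊆ ·) c)
    (h : ∀ S ∈ c, IsPacked w S) : IsPacked w (⋃₀ c) := by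
  classical
  intro Q
  rcases c.eq_empty_or_nonempty with rfl | hne
  · simp
  rw [ENNReal.tsum_eq_iSup_sum]
  refine iSup_le fun s => ?_
  obtain ⟨T, hT, hsT⟩ := DirectedOn.exists_mem_subset_of_finite_of_subset_sUnion hne hc.directedOn
    (s := (s : Set D) ∩ ⋃₀ c) (s.finite_toSet.inter_of_left _) inter_subset_right
  refine le_trans (Finset.sum_le_sum fun P hP => ?_) ((ENNReal.sum_le_tsum s).trans (h T hT Q))
  by_cases hPc : P ∈ ⋃₀ c ∩ Iic Q
  · have : P ∈ T ∩ Iic Q := ⟨hsT ⟨hP, hPc.1⟩, hPc.2⟩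
    simp [indicator_of_mem hPc, indicator_of_mem this]
  · simp [indicator_of_notMem hPc]

/-- From every family one can select a packed subfamily such that every member of the family lies
below an element which is saturated by the subfamily. -/
theorem exists_isPacked {w : D → ℝ≥0∞} (hw : Monotone w) (F : Set D) :
    ∃ S ⊆ F, IsPacked w S ∧
      ∀ P ∈ F, ∃ Q, P ≤ Q ∧ w Q ≤ ∑' P', (S ∩ Iic Q).indicator w P' := by
  classical
  obtain ⟨S, hS⟩ := zorn_subset {T : Set D | T ⊆ F ∧ IsPacked w T} fun c hcS hc =>
    ⟨⋃₀ c, ⟨sUnion_subset fun T hT => (hcS hT).1, isPacked_sUnion hc fun T hT => (hcS hT).2⟩,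
      fun T hT => subset_sUnion_of_mem hT⟩
  refine ⟨S, hS.prop.1, hS.prop.2, fun P hP => ?_⟩
  by_cases hPS : P ∈ S
  · refine ⟨P, le_rfl, le_trans ?_ (ENNReal.le_tsum P)⟩
    rw [indicator_of_mem (show P ∈ S ∩ Iic P from ⟨hPS, le_rfl⟩)]
  have hnot : ¬ IsPacked w (insert P S) := fun h => hPS <|
    hS.le_of_ge (y := insert P S) ⟨insert_subset hP hS.prop.1, h⟩ (subset_insert _ _)
      (mem_insert _ _)
  simp only [IsPacked, not_forall, not_le] at hnot
  obtain ⟨Q, hQ⟩ := hnot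
  have hsum : ∑' P', (insert P S ∩ Iic Q).indicator w P' ≤
      (if P ≤ Q then w P else 0) + ∑' P', (S ∩ Iic Q).indicator w P' := by
    have : (if P ≤ Q then w P else 0) = ∑' P', if P' = P then (if P ≤ Q then w P else 0) else 0 := by
      rw [tsum_ite_eq]
    rw [this, ← ENNReal.tsum_add]
    refine ENNReal.tsum_le_tsum fun P' => ?_
    by_cases hP' : P' = P
    · subst hP'
      by_cases h : P' ≤ Q <;> simp [indicator, h]
    · simp [indicator, hP']
  -- By maximality of S, adding P breaks packing at Q. If P ≤ Q, then w P ≤ w Q accounts for at most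
  -- half of the excess over 2 w Q, so S alone already reaches w Q. Otherwise P does not count and S
  -- itself would fail.
  by_cases hPQ : P ≤ Q
  · refine ⟨Q, hPQ, ?_⟩
    have h := hQ.trans_le hsum
    rw [if_pos hPQ, two_mul] at h
    by_contra! hlt
    exact absurd (add_le_add (hw hPQ) hlt.le) h.not_ge
  · rw [if_neg hPQ, zero_add] at hsum
    exact absurd (hS.prop.2 Q) (hQ.trans_le hsum).not_ge

end Packing

/-! ### Dyadic cubes -/

/-- A half-open dyadic cube of `ℝⁿ`, of side length `2 ^ scale`. -/
@[ext] structure Dyadic (n : ℕ) where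
  /-- the binary logarithm of the side length -/
  scale : ℤ
  /-- the position of the cube in the grid -/
  index : Fin n → ℤ

namespace Dyadic

instance : Countable (Dyadic n) :=
  (show Function.Injective fun P : Dyadic n => (P.scale, P.index) from fun P Q h => by
    simp only [Prod.mk.injEq] at h
    exact Dyadic.ext h.1 h.2).countable

/-- The points of a dyadic cube. -/
def toSet (P : Dyadic n) : Set (EuclideanSpace ℝ (Fin n)) :=
  {x | ∀ i, ⌊x i / 2 ^ P.scale⌋ = P.index i}

theorem toSet_nonempty (P : Dyadic n) : P.toSet.Nonempty := by
  refine ⟨WithLp.toLp 2 fun i => P.index i * 2 ^ P.scale, fun i => ?_⟩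
  have : (2 : ℝ) ^ P.scale ≠ 0 := by positivity
  simp [this]

theorem eq_of_mem {P Q : Dyadic n} (h : P.scale = Q.scale) {x : EuclideanSpace ℝ (Fin n)}
    (hP : x ∈ P.toSet) (hQ : x ∈ Q.toSet) : P = Q :=
  Dyadic.ext h (funext fun i => by rw [← hP i, ← hQ i, h])

instance : PartialOrder (Dyadic n) where
  -- Inclusion alone determines the order of scales except for n = 0, where all cubes are the same
  -- point.
  le P Q := P.scale ≤ Q.scale ∧ P.toSet ⊆ Q.toSet
  le_refl P := ⟨le_rfl, subset_rfl⟩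
  le_trans _ _ _ h h' := ⟨h.1.trans h'.1, h.2.trans h'.2⟩
  le_antisymm P _ h h' :=
    let ⟨_, hx⟩ := P.toSet_nonempty
    eq_of_mem (le_antisymm h.1 h'.1) hx (h.2 hx)

/-- The grids are nested: the coarse index is the integer quotient of the fine one by 2 ^ d. -/
theorem floor_div_eq_of_le {k l : ℤ} (h : k ≤ l) {a b : ℝ}
    (hab : ⌊a / 2 ^ k⌋ = ⌊b / 2 ^ k⌋) : ⌊a / 2 ^ l⌋ = ⌊b / 2 ^ l⌋ := by
  obtain ⟨d, rfl⟩ := Int.le.dest h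
  have key : ∀ c : ℝ, ⌊c / 2 ^ (k + d)⌋ = ⌊c / 2 ^ k⌋ / ((2 ^ d : ℕ) : ℤ) := fun c => by
    rw [← Int.floor_div_natCast, zpow_add₀ two_ne_zero, div_mul_eq_div_div]
    simp
  rw [key, key, hab]

theorem le_of_mem {P Q : Dyadic n} (h : P.scale ≤ Q.scale) {x : EuclideanSpace ℝ (Fin n)}
    (hP : x ∈ P.toSet) (hQ : x ∈ Q.toSet) : P ≤ Q :=
  ⟨h, fun y hy i => by rw [← hQ i]; exact floor_div_eq_of_le h (by rw [hP i, hy i])⟩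

theorem le_or_le_of_mem {P Q : Dyadic n} {x : EuclideanSpace ℝ (Fin n)}
    (hP : x ∈ P.toSet) (hQ : x ∈ Q.toSet) : P ≤ Q ∨ Q ≤ P :=
  (le_total P.scale Q.scale).imp (fun h => le_of_mem h hP hQ) fun h => le_of_mem h hQ hP

/-- Above every member of a family of dyadic cubes of bounded size there is a maximal one. -/
theorem exists_maximal_ge {G : Set (Dyadic n)} {N : ℤ} (hN : ∀ Q ∈ G, Q.scale ≤ N) {P : Dyadic n}
    (hP : P ∈ G) : ∃ Q, P ≤ Q ∧ Maximal (· ∈ G) Q := by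
  obtain ⟨k, ⟨Q, hQ, hPQ, rfl⟩, hmax⟩ := Int.exists_greatest_of_bdd
    (P := fun k => ∃ Q ∈ G, P ≤ Q ∧ Q.scale = k)
    ⟨N, by rintro _ ⟨Q, hQ, -, rfl⟩; exact hN Q hQ⟩ ⟨_, P, hP, le_rfl, rfl⟩
  refine ⟨Q, hPQ, hQ, fun R hR hQR => ?_⟩
  obtain ⟨x, hx⟩ := Q.toSet_nonempty
  exact le_of_mem (hmax _ ⟨R, hR, hPQ.trans hQR, rfl⟩) (hQR.2 hx) hx

/-- The side length. -/
noncomputable def side (P : Dyadic n) : ℝ := 2 ^ P.scale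

theorem side_pos (P : Dyadic n) : 0 < P.side := by unfold side; positivity

theorem side_le_side {P Q : Dyadic n} (h : P ≤ Q) : P.side ≤ Q.side :=
  zpow_le_zpow_right₀ one_le_two h.1

/-- The weight `ℓ(P) ^ β`. -/
noncomputable def weight (β : ℝ) (P : Dyadic n) : ℝ≥0∞ := ENNReal.ofReal (P.side ^ β)

theorem weight_mono {β : ℝ} (hβ : 0 ≤ β) : Monotone (weight β : Dyadic n → ℝ≥0∞) := fun P _ h =>
  ENNReal.ofReal_le_ofReal (Real.rpow_le_rpow P.side_pos.le (side_le_side h) hβ)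

theorem weight_ne_top (β : ℝ) (P : Dyadic n) : P.weight β ≠ ∞ := ENNReal.ofReal_ne_top

theorem weight_pos (β : ℝ) (P : Dyadic n) : 0 < P.weight β :=
  ENNReal.ofReal_pos.2 (Real.rpow_pos_of_pos P.side_pos _)

theorem toReal_weight (β : ℝ) (P : Dyadic n) : (P.weight β).toReal = P.side ^ β :=
  ENNReal.toReal_ofReal (Real.rpow_nonneg P.side_pos.le _)

theorem exists_scale_le_of_weight_le {β : ℝ} (hβ : 0 < β) {M : ℝ≥0∞} (hM : M ≠ ∞) :
    ∃ N : ℤ, ∀ P : Dyadic n, P.weight β ≤ M → P.scale ≤ N := by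
  obtain ⟨N, hN⟩ := pow_unbounded_of_one_lt (M.toReal ^ β⁻¹) (one_lt_two (α := ℝ))
  refine ⟨N, fun P hP => ?_⟩
  have h := ENNReal.toReal_mono hM hP
  rw [toReal_weight] at h
  have h2 : P.side ≤ M.toReal ^ β⁻¹ := by
    rw [Real.le_rpow_inv_iff_of_pos P.side_pos.le ENNReal.toReal_nonneg hβ]
    exact h
  have h3 : (2 : ℝ) ^ P.scale < 2 ^ (N : ℤ) := by
    rw [zpow_natCast]; exact h2.trans_lt hN
  exact ((zpow_lt_zpow_iff_right₀ one_lt_two).1 h3).le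

/-- The points at coordinatewise distance at most the side length from the cube. -/
def enlarge (P : Dyadic n) : Set (EuclideanSpace ℝ (Fin n)) :=
  {x | ∃ y ∈ P.toSet, ∀ i, |x i - y i| ≤ P.side}

theorem enlarge_mono {P Q : Dyadic n} (h : P ≤ Q) : P.enlarge ⊆ Q.enlarge :=
  fun _ ⟨y, hy, hxy⟩ => ⟨y, h.2 hy, fun i => (hxy i).trans (side_le_side h)⟩

theorem toSet_subset_enlarge (P : Dyadic n) : P.toSet ⊆ P.enlarge :=
  fun x hx => ⟨x, hx, fun i => by simpa using P.side_pos.le⟩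

theorem abs_sub_le_side {P : Dyadic n} {x y : EuclideanSpace ℝ (Fin n)} (hx : x ∈ P.toSet)
    (hy : y ∈ P.toSet) (i : Fin n) : |x i - y i| ≤ P.side := by
  have h := Int.abs_sub_lt_one_of_floor_eq_floor ((hx i).trans (hy i).symm)
  have hs := P.side_pos
  rw [side] at hs ⊢
  rw [← sub_div, abs_div, abs_of_pos hs, div_lt_one hs] at h
  exact h.le

/-- Coordinates differ from those of a point of P by at most two sides, so the distance is at most
2√n sides; n + 1 keeps the inequality strict even for n = 0. -/
theorem enlarge_subset_ball (P : Dyadic n) :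
    ∃ x, P.enlarge ⊆ Metric.ball x (P.side * (2 * (n + 1))) := by
  obtain ⟨z, hz⟩ := P.toSet_nonempty
  refine ⟨z, fun x ⟨y, hy, hxy⟩ => ?_⟩
  have hs := P.side_pos
  have hi : ∀ i, dist (x i) (z i) ^ 2 ≤ (2 * P.side) ^ 2 := fun i => by
    refine pow_le_pow_left₀ dist_nonneg ?_ 2
    rw [Real.dist_eq]
    linarith [abs_sub_le (x i) (y i) (z i), hxy i, abs_sub_le_side hy hz i]
  rw [Metric.mem_ball, EuclideanSpace.dist_eq, Real.sqrt_lt' (by positivity)]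
  refine (Finset.sum_le_sum fun i _ => hi i).trans_lt ?_
  rw [Finset.sum_const, Finset.card_univ, Fintype.card_fin, nsmul_eq_mul]
  have : (0 : ℝ) ≤ n := n.cast_nonneg
  nlinarith [mul_pos hs hs, mul_nonneg (mul_pos hs hs).le this]

/-- The `2 ^ n` dyadic cubes of scale `k` at and next to the point `a`. -/
noncomputable def near (a : EuclideanSpace ℝ (Fin n)) (k : ℤ) (e : Fin n → Bool) : Dyadic n :=
  ⟨k, fun i => ⌊a i / 2 ^ k⌋ + if e i then 1 else 0⟩

theorem cube_subset_iUnion_near (a : EuclideanSpace ℝ (Fin n)) {ℓ : ℝ} {k : ℤ}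
    (h : ℓ ≤ 2 ^ k) : cube a ℓ ⊆ ⋃ e, (near a k e).toSet := by
  intro x hx
  -- As ℓ ≤ 2 ^ k, each coordinate index of x is that of a or the next one.
  refine mem_iUnion.2 ⟨fun i => decide (⌊x i / 2 ^ k⌋ ≠ ⌊a i / 2 ^ k⌋), fun i => ?_⟩
  have hk : (0 : ℝ) < 2 ^ k := by positivity
  have h1 : ⌊a i / 2 ^ k⌋ ≤ ⌊x i / 2 ^ k⌋ := Int.floor_mono (by gcongr; exact (hx i).1)
  have h2 : ⌊x i / 2 ^ k⌋ ≤ ⌊a i / 2 ^ k⌋ + 1 := by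
    rw [← Int.floor_add_one]
    refine Int.floor_mono ?_
    rw [div_add_one hk.ne']
    gcongr
    linarith [(hx i).2]
  simp only [near, decide_eq_true_eq]
  split_ifs <;> omega

theorem exists_zpow_two {ℓ : ℝ} (h : 0 < ℓ) : ∃ k : ℤ, ℓ ≤ 2 ^ k ∧ (2 : ℝ) ^ k ≤ 2 * ℓ := by
  obtain ⟨m, hm, hm'⟩ := exists_mem_Ioc_zpow h (one_lt_two (α := ℝ))
  refine ⟨m + 1, hm', ?_⟩
  rw [zpow_add_one₀ two_ne_zero]
  linarith

theorem ball_subset_cube (x : EuclideanSpace ℝ (Fin n)) (r : ℝ) :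
    Metric.ball x r ⊆ cube (WithLp.toLp 2 fun i => x i - r) (2 * r) := by
  intro y hy i
  have h : |y i - x i| ≤ r := by
    have := PiLp.norm_apply_le (y - x) i
    rw [Metric.mem_ball, dist_eq_norm] at hy
    simpa using this.trans hy.le
  have := abs_le.1 h
  simp only
  constructor <;> linarith

end Dyadic

/-! ### Dilations of Young functions and the function `Φ₁` -/

namespace IsYoung

variable {B : ℝ → ℝ} {α : ℝ}

theorem pos (hB : IsYoung B) {t : ℝ} (ht : 0 < t) : 0 < B t := by
  have := hB.strictMonoOn (self_mem_Ici (a := (0 : ℝ))) ht.le ht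
  rwa [hB.map_zero] at this

theorem mono (hB : IsYoung B) {s t : ℝ} (hs : 0 ≤ s) (hst : s ≤ t) : B s ≤ B t :=
  hB.strictMonoOn.monotoneOn hs (hs.trans hst) hst

theorem dilation_pos (hB : IsYoung B) {s : ℝ} (hs : 0 < s) : 0 < dilation B s := by
  refine lt_of_lt_of_le ?_ (le_iSup₂ (f := fun (t : ℝ) (_ : 0 < t) =>
    ENNReal.ofReal (B (s * t) / B t)) 1 one_pos)
  exact ENNReal.ofReal_pos.2 (div_pos (hB.pos (by positivity)) (hB.pos one_pos))

theorem dilation_mono (hB : IsYoung B) {s s' : ℝ} (hs : 0 ≤ s) (h : s ≤ s') :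
    dilation B s ≤ dilation B s' :=
  iSup₂_mono fun t ht => ENNReal.ofReal_le_ofReal <|
    div_le_div_of_nonneg_right (hB.mono (by positivity) (by gcongr)) (hB.pos ht).le

theorem dilation_one (hB : IsYoung B) : dilation B 1 ≤ 1 :=
  iSup₂_le fun t ht => by rw [one_mul, div_self (hB.pos ht).ne', ENNReal.ofReal_one]

theorem map_mul_le (hB : IsYoung B) {s t : ℝ} (ht : 0 ≤ t)
    (hfin : dilation B s ≠ ∞) : B (s * t) ≤ (dilation B s).toReal * B t := by
  rcases ht.eq_or_lt with rfl | ht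
  · simp [hB.map_zero]
  rw [← div_le_iff₀ (hB.pos ht)]
  refine (ENNReal.ofReal_le_iff_le_toReal hfin).1 ?_
  exact le_iSup₂ (f := fun (t : ℝ) (_ : 0 < t) => ENNReal.ofReal (B (s * t) / B t)) t ht

/-- The decrease of B(t)/t^(β/α) enters the proof only here; for α = 0 the factor c^(α/β) is 1. -/
theorem map_rpow_mul_le (hB : IsYoung B) (hα : 0 ≤ α) (hβ : 0 < β)
    (hdec : 0 < α → AntitoneOn (fun t : ℝ => B t / t ^ (β / α)) (Ioi 0)) {c t : ℝ}
    (hc : 1 ≤ c) (ht : 0 < t) : B (c ^ (α / β) * t) ≤ c * B t := by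
  have hc0 : 0 < c := by linarith
  rcases hα.eq_or_lt with rfl | hα
  · simpa using le_mul_of_one_le_left (hB.pos ht).le hc
  have h1 : 1 ≤ c ^ (α / β) := Real.one_le_rpow hc (by positivity)
  have h2 : 0 < c ^ (α / β) * t := by positivity
  have h := hdec hα ht h2 (le_mul_of_one_le_left ht.le h1)
  simp only at h
  have h3 : (c ^ (α / β)) ^ (β / α) = c := by
    rw [← Real.rpow_mul hc0.le, div_mul_div_cancel₀ hβ.ne', div_self hα.ne', Real.rpow_one]
  have h4 : 0 < t ^ (β / α) := by positivity
  rw [Real.mul_rpow (by positivity) ht.le, h3, div_le_div_iff₀ (by positivity) h4] at h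
  refine le_of_mul_le_mul_right (h.trans_eq ?_) h4
  ring

/-- With c = s/u this says that h_B(s^(α/β))/s decreases in s, which is the monotonicity of Φ₁. -/
theorem dilation_rpow_mul_le (hB : IsYoung B) (hα : 0 ≤ α) (hβ : 0 < β)
    (hdec : 0 < α → AntitoneOn (fun t : ℝ => B t / t ^ (β / α)) (Ioi 0)) {c u : ℝ}
    (hc : 1 ≤ c) (hu : 0 < u) :
    dilation B ((c * u) ^ (α / β)) ≤ ENNReal.ofReal c * dilation B (u ^ (α / β)) := by
  have hc0 : 0 < c := by linarith
  refine iSup₂_le fun t ht => ?_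
  refine le_trans ?_ (mul_le_mul_right (le_iSup₂ (f := fun (t : ℝ) (_ : 0 < t) =>
    ENNReal.ofReal (B (u ^ (α / β) * t) / B t)) t ht) _)
  rw [← ENNReal.ofReal_mul hc0.le, ← mul_div_assoc, Real.mul_rpow hc0.le hu.le, mul_assoc]
  refine ENNReal.ofReal_le_ofReal (div_le_div_of_nonneg_right ?_ (hB.pos ht).le)
  exact hB.map_rpow_mul_le hα hβ hdec hc (by positivity)

theorem dilation_rpow_ne_top (hB : IsYoung B) (hα : 0 ≤ α) (hβ : 0 < β)
    (hdec : 0 < α → AntitoneOn (fun t : ℝ => B t / t ^ (β / α)) (Ioi 0)) {u : ℝ}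
    (hu : 0 ≤ u) : dilation B (u ^ (α / β)) ≠ ∞ := by
  refine ne_top_of_le_ne_top ?_ (hB.dilation_mono (by positivity)
    (Real.rpow_le_rpow hu (le_max_left u 1) (by positivity)))
  have h := hB.dilation_rpow_mul_le hα hβ hdec (le_max_right u 1) one_pos
  rw [mul_one, Real.one_rpow] at h
  refine ne_top_of_le_ne_top (ENNReal.mul_ne_top ENNReal.ofReal_ne_top ?_) h
  exact ne_top_of_le_ne_top ENNReal.one_ne_top hB.dilation_one

theorem phiOne_of_ne {s : ℝ≥0∞} (h0 : s ≠ 0) (htop : s ≠ ∞) :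
    phiOne α β B s = s / dilation B (s.toReal ^ (α / β)) := by
  simp [phiOne, h0, htop]

theorem phiOne_top_le {c : ℝ≥0∞} (h : ∀ s, s ≠ 0 → s ≠ ∞ → phiOne α β B s ≤ c) :
    phiOne α β B ∞ ≤ c := by
  rw [phiOne, if_neg ENNReal.top_ne_zero, if_pos rfl]
  refine iSup₂_le fun u hu => ?_
  have h' := h (ENNReal.ofReal u) (ENNReal.ofReal_pos.2 hu).ne' ENNReal.ofReal_ne_top
  rwa [phiOne_of_ne (ENNReal.ofReal_pos.2 hu).ne' ENNReal.ofReal_ne_top,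
    ENNReal.toReal_ofReal hu.le] at h'

theorem phiOne_le_top {s : ℝ≥0∞} : phiOne α β B s ≤ phiOne α β B ∞ := by
  rcases eq_or_ne s 0 with rfl | h0
  · simp [phiOne]
  rcases eq_or_ne s ∞ with rfl | htop
  · exact le_rfl
  rw [phiOne_of_ne h0 htop, phiOne, if_neg ENNReal.top_ne_zero, if_pos rfl]
  refine le_trans ?_ (le_iSup₂ (f := fun (u : ℝ) (_ : 0 < u) =>
    ENNReal.ofReal u / dilation B (u ^ (α / β))) s.toReal (ENNReal.toReal_pos h0 htop))
  rw [ENNReal.ofReal_toReal htop]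

theorem phiOne_mono (hB : IsYoung B) (hα : 0 ≤ α) (hβ : 0 < β)
    (hdec : 0 < α → AntitoneOn (fun t : ℝ => B t / t ^ (β / α)) (Ioi 0)) :
    Monotone (phiOne α β B) := by
  intro u s hus
  rcases eq_or_ne u 0 with rfl | hu0
  · simp [phiOne]
  rcases eq_or_ne s ∞ with rfl | hs
  · exact phiOne_le_top
  have hu := ne_top_of_le_ne_top hs hus
  have hs0 : s ≠ 0 := fun h => hu0 (le_zero_iff.1 (h ▸ hus))
  have hu' := ENNReal.toReal_pos hu0 hu
  have hs' := ENNReal.toReal_pos hs0 hs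
  have hus' := ENNReal.toReal_mono hs hus
  rw [phiOne_of_ne hu0 hu, phiOne_of_ne hs0 hs]
  have hpu := (hB.dilation_pos (Real.rpow_pos_of_pos hu' (α / β))).ne'
  have hps := (hB.dilation_pos (Real.rpow_pos_of_pos hs' (α / β))).ne'
  have hfu := hB.dilation_rpow_ne_top hα hβ hdec hu'.le
  have hfs := hB.dilation_rpow_ne_top hα hβ hdec hs'.le
  have h := hB.dilation_rpow_mul_le hα hβ hdec ((one_le_div hu').2 hus') hu'
  rw [div_mul_cancel₀ _ hu'.ne', ENNReal.ofReal_div_of_pos hu', ENNReal.ofReal_toReal hs,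
    ENNReal.ofReal_toReal hu] at h
  rw [ENNReal.div_le_iff hpu hfu, div_eq_mul_inv, mul_right_comm, ← div_eq_mul_inv,
    ENNReal.le_div_iff_mul_le (Or.inl hps) (Or.inl hfs)]
  calc u * dilation B (s.toReal ^ (α / β))
      ≤ u * (s / u * dilation B (u.toReal ^ (α / β))) := by gcongr
    _ = s * dilation B (u.toReal ^ (α / β)) := by
        rw [← mul_assoc, ENNReal.mul_div_cancel hu0 hu]

/-- `Φ₁` is countably subadditive. -/
theorem phiOne_le_tsum (hB : IsYoung B) (hα : 0 ≤ α) (hβ : 0 < β)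
    (hdec : 0 < α → AntitoneOn (fun t : ℝ => B t / t ^ (β / α)) (Ioi 0)) {ι : Type*}
    (f : ι → ℝ≥0∞) {s : ℝ≥0∞} (hs : s ≤ ∑' i, f i) :
    phiOne α β B s ≤ ∑' i, phiOne α β B (f i) := by
  have hmono := hB.phiOne_mono hα hβ hdec
  have key : ∀ s, s ≠ 0 → s ≠ ∞ → s ≤ ∑' i, f i →
      phiOne α β B s ≤ ∑' i, phiOne α β B (f i) := by
    intro s hs0 hs_top hs
    -- A term above s suffices by monotonicity. Otherwise every f i is at most s, and Φ₁(v)/v =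
    -- 1/h_B(v^(α/β)) is decreasing, so each term is at least f i · Φ₁(s)/s.
    by_cases hf : ∃ i, s < f i
    · obtain ⟨i, hi⟩ := hf
      exact (hmono hi.le).trans (ENNReal.le_tsum i)
    push Not at hf
    rw [phiOne_of_ne hs0 hs_top, div_eq_mul_inv]
    refine (mul_le_mul_left hs _).trans ?_
    rw [← ENNReal.tsum_mul_right]
    refine ENNReal.tsum_le_tsum fun i => ?_
    rcases eq_or_ne (f i) 0 with h0 | h0
    · simp [h0]
    rw [phiOne_of_ne h0 (ne_top_of_le_ne_top hs_top (hf i)), div_eq_mul_inv]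
    refine mul_le_mul_right (ENNReal.inv_le_inv.2 ?_) _
    exact hB.dilation_mono (by positivity)
      (Real.rpow_le_rpow ENNReal.toReal_nonneg (ENNReal.toReal_mono hs_top (hf i)) (by positivity))
  rcases eq_or_ne s 0 with rfl | hs0
  · simp [phiOne]
  rcases eq_or_ne s ∞ with rfl | hs_top
  · exact phiOne_top_le fun u hu0 hu_top => key u hu0 hu_top (le_top.trans hs)
  · exact key s hs0 hs_top hs

end IsYoung

/-! ### Hausdorff content and packed families of dyadic cubes -/

theorem exists_hausdorffContent_enlarge_le (n : ℕ) (hβ : 0 < β) :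
    ∃ K : ℝ≥0, ∀ P : Dyadic n, hausdorffContent n β P.enlarge ≤ K * P.weight β := by
  refine ⟨(Real.pi ^ (β / 2) / Real.Gamma (β / 2 + 1) * (2 * (n + 1)) ^ β).toNNReal, fun P => ?_⟩
  obtain ⟨x, hx⟩ := P.enlarge_subset_ball
  have hs := P.side_pos
  have hω := ballVolume_pos hβ
  refine (hausdorffContent_le_ballCost hβ (by positivity) hx).trans_eq ?_
  rw [ballCost, Dyadic.weight, ← ENNReal.ofReal, ← ENNReal.ofReal_mul (by positivity),
    Real.mul_rpow hs.le (by positivity)]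
  ring_nf

/-- The ball lies in a cube of side 2r, which 2^n dyadic cubes of side at most 4r cover. -/
theorem exists_ball_cover (n : ℕ) (hβ : 0 < β) :
    ∃ K : ℝ≥0, ∀ (x : EuclideanSpace ℝ (Fin n)) (r : ℝ), 0 < r →
      ∃ P : (Fin n → Bool) → Dyadic n, Metric.ball x r ⊆ ⋃ e, (P e).toSet ∧
        ∑' e, (P e).weight β ≤ K * ballCost β r := by
  have hω := ballVolume_pos hβ
  refine ⟨2 ^ n * (4 ^ β / (Real.pi ^ (β / 2) / Real.Gamma (β / 2 + 1))).toNNReal,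
    fun x r hr => ?_⟩
  obtain ⟨k, hk, hk'⟩ := Dyadic.exists_zpow_two (show 0 < 2 * r by positivity)
  refine ⟨_, (Dyadic.ball_subset_cube x r).trans (Dyadic.cube_subset_iUnion_near _ hk), ?_⟩
  have hle : ∀ e, (Dyadic.near (WithLp.toLp 2 fun i => x i - r) k e).weight β ≤
      (4 ^ β / (Real.pi ^ (β / 2) / Real.Gamma (β / 2 + 1))).toNNReal * ballCost β r := by
    intro e
    rw [ballCost, ← ENNReal.ofReal, ← ENNReal.ofReal_mul (by positivity), ← mul_assoc,
      div_mul_cancel₀ _ hω.ne', ← Real.mul_rpow (by norm_num) hr.le]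
    refine ENNReal.ofReal_le_ofReal (Real.rpow_le_rpow (Dyadic.side_pos _).le ?_ hβ.le)
    change (2 : ℝ) ^ k ≤ 4 * r
    linarith
  refine (ENNReal.tsum_le_tsum hle).trans_eq ?_
  rw [tsum_fintype, Finset.sum_const, Finset.card_univ]
  simp [mul_assoc]

/-- Each Q in S is charged to the covering cubes. If Q lies in some P j, its weight is charged
there, and packing bounds these charges by 2 w(P j). Otherwise every P j meeting Q lies inside Q; as
S is an antichain, P j lies in at most one such Q and is charged once. Hence 3 = 2 + 1. -/
theorem tsum_hausdorffContent_inter_le_of_cover (hβ : 0 < β) {K : ℝ≥0}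
    (hK : ∀ P : Dyadic n, hausdorffContent n β P.enlarge ≤ K * P.weight β)
    {S : Set (Dyadic n)} (hS : IsPacked (Dyadic.weight β) S) (hS' : IsAntichain (· ≤ ·) S)
    {ι : Type*} [Countable ι] (P : ι → Dyadic n) {A : Set (EuclideanSpace ℝ (Fin n))}
    (hA : A ⊆ ⋃ j, (P j).toSet) :
    ∑' Q : S, hausdorffContent n β (A ∩ Q.1.toSet) ≤ 3 * K * ∑' j, (P j).weight β := by
  classical
  have hK' : ∀ P : Dyadic n, hausdorffContent n β P.toSet ≤ K * P.weight β := fun P =>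
    (hausdorffContent_mono P.toSet_subset_enlarge).trans (hK P)
  have hterm : ∀ Q : S, hausdorffContent n β (A ∩ Q.1.toSet) ≤
      ∑' j, K * ((if Q.1 ≤ P j then Q.1.weight β else 0) +
        (if P j ≤ Q.1 then (P j).weight β else 0)) := by
    intro Q
    by_cases h : ∃ j, Q.1 ≤ P j
    · obtain ⟨j, hj⟩ := h
      refine le_trans ?_ (ENNReal.le_tsum j)
      rw [if_pos hj]
      exact ((hausdorffContent_mono inter_subset_right).trans (hK' Q.1)).trans
        (mul_le_mul_right le_self_add _)
    · push Not at h
      refine (hausdorffContent_le_tsum_of_subset hβ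
        (fun j => if P j ≤ Q.1 then (P j).toSet else ∅) ?_).trans (ENNReal.tsum_le_tsum fun j => ?_)
      · rintro x ⟨hxA, hxQ⟩
        obtain ⟨j, hj⟩ := mem_iUnion.1 (hA hxA)
        have hle := (Dyadic.le_or_le_of_mem hj hxQ).resolve_right (h j)
        exact mem_iUnion.2 ⟨j, by simpa [hle] using hj⟩
      · split_ifs with h1 h2
        · exact absurd h2 (h j)
        · simpa using hK' (P j)
        · simp [hausdorffContent_empty hβ]
        · simp [hausdorffContent_empty hβ]
  have hbelow : ∀ j, ∑' Q : S, (if Q.1 ≤ P j then Q.1.weight β else 0) ≤ 2 * (P j).weight β := by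
    intro j
    refine le_trans (le_of_eq ?_) (hS (P j))
    rw [tsum_subtype S fun Q : Dyadic n => if Q ≤ P j then Q.weight β else 0]
    refine tsum_congr fun Q => ?_
    by_cases h1 : Q ∈ S <;> by_cases h2 : Q ≤ P j <;> simp [indicator, h1, h2]
  have habove : ∀ j, ∑' Q : S, (if P j ≤ Q.1 then (P j).weight β else 0) ≤ (P j).weight β := by
    intro j
    by_cases h : ∃ Q : S, P j ≤ Q.1
    · obtain ⟨Q, hQ⟩ := h
      rw [tsum_eq_single Q, if_pos hQ]
      intro R hR
      refine if_neg fun hjR => hR ?_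
      obtain ⟨x, hx⟩ := (P j).toSet_nonempty
      rcases Dyadic.le_or_le_of_mem (hjR.2 hx) (hQ.2 hx) with h | h
      · exact Subtype.ext (hS'.eq R.2 Q.2 h)
      · exact Subtype.ext (hS'.eq Q.2 R.2 h).symm
    · push Not at h
      simp [h]
  calc ∑' Q : S, hausdorffContent n β (A ∩ Q.1.toSet)
      ≤ ∑' Q : S, ∑' j, K * ((if Q.1 ≤ P j then Q.1.weight β else 0) +
        (if P j ≤ Q.1 then (P j).weight β else 0)) := ENNReal.tsum_le_tsum hterm
    _ = ∑' j, K * (∑' Q : S, (if Q.1 ≤ P j then Q.1.weight β else 0) +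
        ∑' Q : S, (if P j ≤ Q.1 then (P j).weight β else 0)) := by
        rw [ENNReal.tsum_comm]
        simp only [ENNReal.tsum_mul_left, ENNReal.tsum_add]
    _ ≤ ∑' j, K * (2 * (P j).weight β + (P j).weight β) := by
        refine ENNReal.tsum_le_tsum fun j => ?_
        gcongr
        · exact hbelow j
        · exact habove j
    _ = 3 * K * ∑' j, (P j).weight β := by
        rw [← ENNReal.tsum_mul_left]
        refine tsum_congr fun j => ?_
        ring

/-- On a packed family of disjoint dyadic cubes the Hausdorff content is almost superadditive. -/
theorem exists_tsum_hausdorffContent_inter_le (n : ℕ) (hβ : 0 < β) :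
    ∃ K : ℝ≥0, ∀ S : Set (Dyadic n), IsPacked (Dyadic.weight β) S → IsAntichain (· ≤ ·) S →
      ∀ A : Set (EuclideanSpace ℝ (Fin n)),
        ∑' Q : S, hausdorffContent n β (A ∩ Q.1.toSet) ≤ K * hausdorffContent n β A := by
  obtain ⟨K, hK⟩ := exists_hausdorffContent_enlarge_le n hβ
  obtain ⟨K', hK'⟩ := exists_ball_cover n hβ
  -- The summand 1 makes the constant nonzero, so one can divide by it and compare with each c above
  -- the content.
  refine ⟨3 * K * K' + 1, fun S hS hS' A => ?_⟩
  rw [mul_comm, ← ENNReal.div_le_iff_le_mul (Or.inl (by simp)) (Or.inl ENNReal.coe_ne_top)]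
  refine le_of_forall_gt fun c hc => ?_
  obtain ⟨x, r, hr, hA, hlt⟩ := exists_cover_of_hausdorffContent_lt hc
  refine lt_of_le_of_lt ?_ hlt
  rw [ENNReal.div_le_iff_le_mul (Or.inl (by simp)) (Or.inl ENNReal.coe_ne_top)]
  choose P hP hP' using fun i => hK' (x i) (r i) (hr i)
  have hcover : A ⊆ ⋃ p : ℕ × (Fin n → Bool), (P p.1 p.2).toSet := by
    intro y hy
    obtain ⟨i, hi⟩ := mem_iUnion.1 (hA hy)
    obtain ⟨e, he⟩ := mem_iUnion.1 (hP i hi)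
    exact mem_iUnion.2 ⟨(i, e), he⟩
  refine (tsum_hausdorffContent_inter_le_of_cover hβ hK hS hS' _ hcover).trans ?_
  rw [ENNReal.tsum_prod (f := fun i e => (P i e).weight β)]
  calc 3 * K * ∑' i, ∑' e, (P i e).weight β
      ≤ 3 * K * ∑' i, K' * ballCost β (r i) := by
        gcongr with i
        exact hP' i
    _ = 3 * K * K' * ∑' i, ballCost β (r i) := by simp only [ENNReal.tsum_mul_left, mul_assoc]
    _ ≤ (∑' i, ballCost β (r i)) * (3 * K * K' + 1 : ℝ≥0) := by
        rw [mul_comm]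
        gcongr
        push_cast
        exact le_self_add

/-- A packed subfamily controls the content of the union of the enlarged cubes of the family. -/
theorem exists_isPacked_hausdorffContent_le (n : ℕ) (hβ : 0 < β) :
    ∃ K : ℝ≥0, ∀ F : Set (Dyadic n), ∃ S ⊆ F, IsPacked (Dyadic.weight β) S ∧
      hausdorffContent n β (⋃ P ∈ F, P.enlarge) ≤ K * ∑' P : S, P.1.weight β := by
  obtain ⟨K, hK⟩ := exists_hausdorffContent_enlarge_le n hβ
  refine ⟨K + 1, fun F => ?_⟩
  obtain ⟨S, hSF, hS, hsat⟩ := exists_isPacked (Dyadic.weight_mono (n := n) hβ.le) F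
  refine ⟨S, hSF, hS, ?_⟩
  rw [tsum_subtype S fun P : Dyadic n => P.weight β]
  rcases eq_or_ne (∑' P, S.indicator (Dyadic.weight β) P) ∞ with htop | htop
  · rw [htop, ENNReal.mul_top (by simp)]
    exact le_top
  -- G consists of the cubes saturated by S. The finite total weight of S bounds their size, so
  -- maximal ones exist; these are disjoint, so each member of S is counted below at most one of
  -- them.
  set G : Set (Dyadic n) :=
    {Q | Q.weight β ≤ ∑' P, (S ∩ Iic Q).indicator (Dyadic.weight β) P} with hG
  obtain ⟨N, hN⟩ := Dyadic.exists_scale_le_of_weight_le (n := n) hβ htop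
  have hGN : ∀ Q ∈ G, Q.scale ≤ N := fun Q hQ => hN Q <| le_trans hQ <|
    ENNReal.tsum_le_tsum fun P =>
      indicator_le_indicator_of_subset inter_subset_left (fun _ => zero_le) P
  set M : Set (Dyadic n) := {Q | Maximal (· ∈ G) Q} with hM
  have hsub : (⋃ P ∈ F, P.enlarge) ⊆ ⋃ Q : M, Q.1.enlarge := by
    refine iUnion₂_subset fun P hP => ?_
    obtain ⟨Q, hPQ, hQ⟩ := hsat P hP
    obtain ⟨R, hQR, hR⟩ := Dyadic.exists_maximal_ge hGN hQ
    exact (Dyadic.enlarge_mono (hPQ.trans hQR)).trans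
      (subset_iUnion_of_subset (⟨R, hR⟩ : M) le_rfl)
  calc hausdorffContent n β (⋃ P ∈ F, P.enlarge)
      ≤ ∑' Q : M, hausdorffContent n β Q.1.enlarge :=
        hausdorffContent_le_tsum_of_subset hβ _ hsub
    _ ≤ ∑' Q : M, K * ∑' P, (S ∩ Iic Q.1).indicator (Dyadic.weight β) P := by
        refine ENNReal.tsum_le_tsum fun Q => (hK Q.1).trans ?_
        gcongr
        exact Q.2.prop
    _ = K * ∑' P, ∑' Q : M, (S ∩ Iic Q.1).indicator (Dyadic.weight β) P := by
        rw [ENNReal.tsum_mul_left, ENNReal.tsum_comm]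
    _ ≤ K * ∑' P, S.indicator (Dyadic.weight β) P := by
        gcongr with P
        by_cases h : ∃ Q : M, P ∈ S ∩ Iic Q.1
        · obtain ⟨Q, hQ⟩ := h
          rw [tsum_eq_single Q, indicator_of_mem hQ, indicator_of_mem hQ.1]
          intro R hR
          refine indicator_of_notMem (fun hPR => hR ?_) _
          obtain ⟨x, hx⟩ := P.toSet_nonempty
          have hPR' : P ≤ R.1 := hPR.2
          have hPQ' : P ≤ Q.1 := hQ.2
          rcases Dyadic.le_or_le_of_mem (hPR'.2 hx) (hPQ'.2 hx) with h | h
          · exact Subtype.ext (le_antisymm h (R.2.le_of_ge Q.2.prop h))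
          · exact Subtype.ext (le_antisymm (Q.2.le_of_ge R.2.prop h) h)
        · push Not at h
          simp [indicator_of_notMem (h _)]
    _ ≤ (K + 1 : ℝ≥0) * ∑' P, S.indicator (Dyadic.weight β) P := by
        gcongr
        exact le_self_add

variable {α : ℝ} {B : ℝ → ℝ}

/-! ### The maximal operator and dyadic cubes -/

theorem exists_cube_of_lt_fracOrliczMaximal {f : EuclideanSpace ℝ (Fin n) → ℝ}
    (hf : ∀ x, 0 ≤ f x) {t : ℝ} (ht : 0 < t) {x : EuclideanSpace ℝ (Fin n)}
    (hx : ENNReal.ofReal t < fracOrliczMaximal α β B f x) :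
    ∃ (a : EuclideanSpace ℝ (Fin n)) (ℓ : ℝ), 0 < ℓ ∧ x ∈ cube a ℓ ∧
      ENNReal.ofReal (ℓ ^ β) < choquetIntegral (hausdorffContent n β) (cube a ℓ)
        (fun y => B (ℓ ^ α * (f y / t))) := by
  simp only [fracOrliczMaximal, lt_iSup_iff] at hx
  obtain ⟨a, ℓ, hℓ, hxa, hlt⟩ := hx
  refine ⟨a, ℓ, hℓ, hxa, ?_⟩
  by_contra! hle
  have hℓα : 0 < ℓ ^ α := Real.rpow_pos_of_pos hℓ α
  -- Otherwise t / ℓ^α would be admissible in the Luxemburg infimum.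
  have hlux : luxemburg β B a ℓ f ≤ ENNReal.ofReal (t / ℓ ^ α) := by
    refine iInf_le_of_le (t / ℓ ^ α) <| iInf_le_of_le (by positivity) <| iInf_le_of_le ?_ le_rfl
    refine le_of_eq_of_le ?_ hle
    congr 1
    funext y
    rw [abs_of_nonneg (hf y)]
    congr 1
    field_simp
  refine absurd hlt (not_lt.2 ?_)
  refine (mul_le_mul_right hlux _).trans_eq ?_
  rw [← ENNReal.ofReal_mul hℓα.le, mul_div_cancel₀ _ hℓα.ne']

/-- Pigeonhole: one of the 2^n dyadic cubes covering the given cube carries at least the fraction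
2^(-n) of the integral. The factor 2^β comes from 2^k ≤ 2ℓ. -/
theorem exists_dyadic_of_cube (hα : 0 ≤ α) (hβ : 0 < β) (hB : IsYoung B)
    {g : EuclideanSpace ℝ (Fin n) → ℝ} (hg : ∀ x, 0 ≤ g x) {a : EuclideanSpace ℝ (Fin n)}
    {ℓ : ℝ} (hℓ : 0 < ℓ) (h : ENNReal.ofReal (ℓ ^ β) <
      choquetIntegral (hausdorffContent n β) (cube a ℓ) (fun y => B (ℓ ^ α * g y))) :
    ∃ P : Dyadic n, cube a ℓ ⊆ P.enlarge ∧
      P.weight β ≤ ENNReal.ofReal (2 ^ β * 2 ^ n) *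
        choquetIntegral (hausdorffContent n β) P.toSet (fun y => B (P.side ^ α * g y)) := by
  have hmono : Monotone (hausdorffContent n β) := fun _ _ => hausdorffContent_mono
  obtain ⟨k, hk, hk'⟩ := Dyadic.exists_zpow_two hℓ
  set I : (Fin n → Bool) → ℝ≥0∞ := fun e => choquetIntegral (hausdorffContent n β)
    (cube a ℓ ∩ (Dyadic.near a k e).toSet) (fun y => B (ℓ ^ α * g y)) with hI
  have hsum : ENNReal.ofReal (ℓ ^ β) < ∑' e, I e := h.trans_le <|
    choquetIntegral_le_tsum hmono (fun _ _ => hausdorffContent_le_tsum_of_subset hβ _) _ _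
      (Dyadic.cube_subset_iUnion_near a hk) _
  obtain ⟨e, he⟩ : ∃ e, ENNReal.ofReal (ℓ ^ β) < 2 ^ n * I e := by
    by_contra! hle
    have h1 : ∑' e, 2 ^ n * I e ≤ 2 ^ n * ENNReal.ofReal (ℓ ^ β) := by
      refine (ENNReal.tsum_le_tsum hle).trans_eq ?_
      rw [tsum_fintype, Finset.sum_const, Finset.card_univ]
      simp
    rw [ENNReal.tsum_mul_left] at h1
    exact absurd ((ENNReal.mul_le_mul_iff_right (by simp) (by simp)).1 h1) hsum.not_ge
  set P := Dyadic.near a k e with hP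
  have hPs : P.side = 2 ^ k := rfl
  refine ⟨P, ?_, ?_⟩
  -- The strict inequality for `I e` rules out an empty intersection, and a common point puts the
  -- whole cube within one side of P.
  · obtain ⟨y, hy⟩ : (cube a ℓ ∩ P.toSet).Nonempty := by
      by_contra hne
      rw [not_nonempty_iff_eq_empty] at hne
      simp [hI, ← hP, hne, choquetIntegral_empty (hausdorffContent_empty hβ)] at he
    refine fun x hx => ⟨y, hy.2, fun i => ?_⟩
    have h1 := hx i
    have h2 := hy.1 i
    rw [hPs, abs_le]
    constructor <;> linarith
  · have hw : P.weight β ≤ ENNReal.ofReal (2 ^ β) * ENNReal.ofReal (ℓ ^ β) := by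
      rw [← ENNReal.ofReal_mul (by positivity), ← Real.mul_rpow zero_le_two hℓ.le]
      exact ENNReal.ofReal_le_ofReal (Real.rpow_le_rpow P.side_pos.le hk' hβ.le)
    refine hw.trans ?_
    rw [ENNReal.ofReal_mul (by positivity), mul_assoc]
    refine mul_le_mul_right (he.le.trans ?_) _
    rw [ENNReal.ofReal_pow zero_le_two, ENNReal.ofReal_ofNat]
    refine mul_le_mul_right (choquetIntegral_mono hmono inter_subset_right fun y _ => ?_) _
    refine hB.mono (mul_nonneg (Real.rpow_nonneg hℓ.le _) (hg y)) ?_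
    exact mul_le_mul_of_nonneg_right (Real.rpow_le_rpow hℓ.le hk hα) (hg y)

theorem phiOne_weight_le (hα : 0 ≤ α) (hβ : 0 < β) (hB : IsYoung B)
    (hdec : 0 < α → AntitoneOn (fun t : ℝ => B t / t ^ (β / α)) (Ioi 0))
    {g : EuclideanSpace ℝ (Fin n) → ℝ} (hg : ∀ x, 0 ≤ g x) {P : Dyadic n} {κ : ℝ≥0∞}
    (hP : P.weight β ≤ κ *
      choquetIntegral (hausdorffContent n β) P.toSet (fun y => B (P.side ^ α * g y))) :
    phiOne α β B (P.weight β) ≤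
      κ * choquetIntegral (hausdorffContent n β) P.toSet (fun y => B (g y)) := by
  have hmono : Monotone (hausdorffContent n β) := fun _ _ => hausdorffContent_mono
  have hpow : (P.weight β).toReal ^ (α / β) = P.side ^ α := by
    rw [P.toReal_weight, ← Real.rpow_mul P.side_pos.le, mul_div_cancel₀ _ hβ.ne']
  rw [IsYoung.phiOne_of_ne (P.weight_pos β).ne' (P.weight_ne_top β), hpow]
  have hpos := hB.dilation_pos (Real.rpow_pos_of_pos P.side_pos α)
  have hfin : dilation B (P.side ^ α) ≠ ∞ :=
    hpow ▸ hB.dilation_rpow_ne_top hα hβ hdec ENNReal.toReal_nonneg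
  refine ENNReal.div_le_of_le_mul (hP.trans ?_)
  rw [mul_assoc]
  refine mul_le_mul_right ?_ _
  refine (choquetIntegral_mono hmono subset_rfl fun y _ => hB.map_mul_le (hg y) hfin).trans_eq ?_
  rw [choquetIntegral_const_mul hmono _ _ (ENNReal.toReal_pos hpos.ne' hfin),
    ENNReal.ofReal_toReal hfin, mul_comm]

theorem exists_phiOne_superlevel_le (n : ℕ) (hα : 0 ≤ α) (hβ : 0 < β) (hB : IsYoung B)
    (hdec : 0 < α → AntitoneOn (fun t : ℝ => B t / t ^ (β / α)) (Ioi 0)) :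
    ∃ C : ℝ≥0, 0 < C ∧ ∀ f : EuclideanSpace ℝ (Fin n) → ℝ, (∀ x, 0 ≤ f x) → ∀ t : ℝ, 0 < t →
      phiOne α β B (hausdorffContent n β
          {x | ENNReal.ofReal t < fracOrliczMaximal α β B f x}) ≤
        C * choquetIntegral (hausdorffContent n β) univ (fun x => B (f x / t)) := by
  have hmono : Monotone (hausdorffContent n β) := fun _ _ => hausdorffContent_mono
  have hphi := hB.phiOne_mono hα hβ hdec
  obtain ⟨K₁, hK₁⟩ := exists_isPacked_hausdorffContent_le n hβ
  obtain ⟨K₂, hK₂⟩ := exists_tsum_hausdorffContent_inter_le n hβ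
  obtain ⟨N, hN⟩ := exists_nat_ge K₁
  set κ : ℝ≥0 := (2 ^ β * 2 ^ n : ℝ).toNNReal with hκ
  have hκ0 : 0 < κ := Real.toNNReal_pos.2 (by positivity)
  -- The two summands serve the cases of bounded and of unbounded scales in `F`.
  refine ⟨N * κ * K₂ + κ, by positivity, fun f hf t ht => ?_⟩
  set g : EuclideanSpace ℝ (Fin n) → ℝ := fun x => f x / t
  have hg : ∀ x, 0 ≤ g x := fun x => div_nonneg (hf x) ht.le
  set I := choquetIntegral (hausdorffContent n β) univ (fun x => B (g x)) with hI
  set E := {x | ENNReal.ofReal t < fracOrliczMaximal α β B f x} with hE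
  set F : Set (Dyadic n) := {P | P.weight β ≤ κ *
    choquetIntegral (hausdorffContent n β) P.toSet (fun y => B (P.side ^ α * g y))} with hF
  have hEF : ∀ x ∈ E, ∃ P ∈ F, x ∈ P.enlarge := fun x hx => by
    obtain ⟨a, ℓ, hℓ, hxa, hlt⟩ := exists_cube_of_lt_fracOrliczMaximal hf ht hx
    obtain ⟨P, hP, hP'⟩ := exists_dyadic_of_cube hα hβ hB hg hℓ hlt
    exact ⟨P, hP', hP hxa⟩
  have hFphi : ∀ P ∈ F, phiOne α β B (P.weight β) ≤
      κ * choquetIntegral (hausdorffContent n β) P.toSet (fun y => B (g y)) := fun P hP =>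
    phiOne_weight_le hα hβ hB hdec hg hP
  by_cases hbdd : ∃ M : ℤ, ∀ P ∈ F, P.scale ≤ M
  · obtain ⟨M, hM⟩ := hbdd
    obtain ⟨S, hSF, hS, hle⟩ := hK₁ {P | Maximal (· ∈ F) P}
    have hanti : IsAntichain (· ≤ ·) S := (setOfPred_maximal_antichain (· ∈ F)).subset hSF
    have hEsub : E ⊆ ⋃ P ∈ {P | Maximal (· ∈ F) P}, P.enlarge := fun x hx => by
      obtain ⟨P, hP, hxP⟩ := hEF x hx
      obtain ⟨Q, hPQ, hQ⟩ := Dyadic.exists_maximal_ge hM hP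
      exact mem_iUnion₂.2 ⟨Q, hQ, Dyadic.enlarge_mono hPQ hxP⟩
    -- The factor K₁ becomes N copies of each cube, so that subadditivity of Φ₁ absorbs it.
    have hEle : hausdorffContent n β E ≤ ∑' p : S × Fin N, p.1.1.weight β := by
      refine (hmono hEsub).trans (hle.trans ?_)
      rw [ENNReal.tsum_prod (f := fun (Q : S) (_ : Fin N) => Q.1.weight β)]
      simp only [tsum_fintype, Finset.sum_const, Finset.card_univ, Fintype.card_fin, nsmul_eq_mul,
        ENNReal.tsum_mul_left]
      gcongr
      exact_mod_cast hN
    calc phiOne α β B (hausdorffContent n β E)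
        ≤ ∑' p : S × Fin N, phiOne α β B (p.1.1.weight β) :=
          hB.phiOne_le_tsum hα hβ hdec _ hEle
      _ = N * ∑' Q : S, phiOne α β B (Q.1.weight β) := by
          rw [ENNReal.tsum_prod (f := fun (Q : S) (_ : Fin N) => phiOne α β B (Q.1.weight β))]
          simp only [tsum_fintype, Finset.sum_const, Finset.card_univ, Fintype.card_fin,
            nsmul_eq_mul, ENNReal.tsum_mul_left]
      _ ≤ N * ∑' Q : S, κ * choquetIntegral (hausdorffContent n β) Q.1.toSet
            (fun y => B (g y)) := by
          gcongr with Q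
          exact hFphi _ (hSF Q.2).prop
      _ ≤ N * (κ * (K₂ * I)) := by
          rw [ENNReal.tsum_mul_left]
          gcongr
          exact tsum_choquetIntegral_le hmono (fun Q : S => Q.1.toSet) (hK₂ S hS hanti) _
      _ ≤ (N * κ * K₂ + κ : ℝ≥0) * I := by
          push_cast
          rw [add_mul, mul_assoc, mul_assoc]
          exact le_self_add
  · push Not at hbdd
    -- Each finite s is dominated by the weight of some cube in `F`, and Φ₁ of that weight is at
    -- most κ I.
    have htop : phiOne α β B ∞ ≤ κ * I := by
      refine IsYoung.phiOne_top_le fun s _ hs => ?_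
      obtain ⟨M, hM⟩ := Dyadic.exists_scale_le_of_weight_le (n := n) hβ hs
      obtain ⟨P, hP, hPM⟩ := hbdd M
      have hsP : s ≤ P.weight β := by
        by_contra! hlt
        exact absurd (hM P hlt.le) hPM.not_ge
      refine (hphi hsP).trans ((hFphi P hP).trans ?_)
      gcongr
      exact choquetIntegral_mono hmono (subset_univ _) fun _ _ => le_rfl
    refine IsYoung.phiOne_le_top.trans (htop.trans ?_)
    gcongr
    exact le_add_self

end CapacitaryOrlicz

theorem theorem3 (n : ℕ) (α β : ℝ) (hα : 0 ≤ α) (hαβ : α < β) (hβn : β ≤ n)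
    (B : ℝ → ℝ) (hB : CapacitaryOrlicz.IsYoung B)
    (hdec : 0 < α → AntitoneOn (fun t : ℝ => B t / t ^ (β / α)) (Set.Ioi 0)) :
    ∃ C : ℝ≥0, 0 < C ∧
      ∀ (C₁ : ℝ≥0) (Φ : ℝ≥0∞ → ℝ≥0∞),
        (∀ s : ℝ≥0∞, Φ s ≤ (C₁ : ℝ≥0∞) * CapacitaryOrlicz.phiOne α β B s) →
        ∀ f : EuclideanSpace ℝ (Fin n) → ℝ, (∀ x, 0 ≤ f x) →
          CapacitaryOrlicz.MemOrlicz β B f →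
          ∀ t : ℝ, 0 < t →
            Φ (CapacitaryOrlicz.hausdorffContent n β
                {x | ENNReal.ofReal t < CapacitaryOrlicz.fracOrliczMaximal α β B f x})
              ≤ (C : ℝ≥0∞) * (C₁ : ℝ≥0∞) *
                CapacitaryOrlicz.choquetIntegral (CapacitaryOrlicz.hausdorffContent n β) Set.univ
                  (fun x => B (f x / t)) := by
  obtain ⟨C, hC, h⟩ :=
    CapacitaryOrlicz.exists_phiOne_superlevel_le n hα (hα.trans_lt hαβ) hB hdec
  refine ⟨C, hC, fun C₁ Φ hΦ f hf _ t ht => (hΦ _).trans ?_⟩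
  rw [mul_comm (C : ℝ≥0∞), mul_assoc]
  exact mul_le_mul_right (h f hf t ht) _
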